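/- Let $d\ge 2$ be an integer. A brick is a closed box $B=\prod_{i=1}^d[a_i,b_i]\subset\mathbb{R}^d$ with $a_i<b_i$ for all $i$; its sidelengths $b_i-a_i$, arranged in nondecreasing order, are denoted $w_1(B)\le\dots\le w_d(B)$, and $B$ is a cube if they are all equal. For a finite family $\mathcal{B}$ of bricks put \[\mathrm{vol}(\mathcal{B})=\sum_{B\in\mathcal{B}}w_1(B)w_2(B)\cdots w_d(B),\qquad \mathrm{surf}_\delta(\mathcal{B})=\sum_{B\in\mathcal{B}}w_1(B)^\delta w_2(B)\cdots w_d(B).\] Proposition 3.1. Let $\frac1d<t<\frac1{d-1}$ and $0<\delta<1$ with $(d-1)t+\delta t<1$, and let $C_1,C_2>0$. Then there is $M_0$ such that for every real $M\ge M_0$ there is $N_0\in\mathbb{N}$ with the following property. Let $n_{\max}\ge n_0\ge N_0$ be integers, and let $\mathcal{B}$ be a finite family of bricks with pairwise disjoint interiors such that \[\mathrm{vol}(\mathcal{B})=\sum_{n=n_0}^\infty\frac1{n^{dt}},\qquad \mathrm{surf}_\delta(\mathcal{B})\le \frac{C_1}{M^{1-\delta/2}}\sum_{n=1}^{n_0-1}\frac1{n^{(d-1)t+\delta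 t}},\qquad w_d(B)\le C_2\ \text{ for all } B\in\mathcal{B}.\] Then $\bigcup_{B\in\mathcal{B}}B$ can be packed by the cubes of sidelength $n^{-t}$, $n_0\le n<n_{\max}$: there are cubes $Q_n\subseteq\bigcup_{B\in\mathcal{B}}B$ with faces parallel to the coordinate hyperplanes, $Q_n$ of sidelength $n^{-t}$, for $n_0\le n<n_{\max}$, whose interiors are pairwise disjoint. -/

import Mathlib

/-- A brick positioned in `ℝ^d`: a closed, nondegenerate, axis-parallel box
`[a₁, b₁] × ⋯ × [a_d, b_d]`. -/
structure Brick (d : ℕ) where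
  lower : Fin d → ℝ
  upper : Fin d → ℝ
  lower_lt_upper : ∀ i, lower i < upper i

namespace Brick

variable {d : ℕ}

/-- The set of points of the brick. -/
def toSet (B : Brick d) : Set (Fin d → ℝ) := Set.Icc B.lower B.upper

/-- The sidelength in the `i`-th coordinate direction. -/
def side (B : Brick d) (i : Fin d) : ℝ := B.upper i - B.lower i

/-- The sidelengths in nondecreasing order. With indices starting from `0`, `B.w 0` is the width
of `B` and `B.w (d - 1)` is its largest sidelength. -/
noncomputable def w (B : Brick d) : Fin d → ℝ := B.side ∘ Tuple.sort B.side

/-- The volume `w₁ w₂ ⋯ w_d` of a brick. -/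
noncomputable def vol (B : Brick d) : ℝ := ∏ i, B.w i

/-- The weighted surface area `w₁ ^ δ * w₂ * ⋯ * w_d` of a brick. -/
noncomputable def surf (δ : ℝ) (B : Brick d) : ℝ :=
  ∏ i : Fin d, if (i : ℕ) = 0 then B.w i ^ δ else B.w i

/-- The brick is a cube of sidelength `s`. -/
def IsCube (B : Brick d) (s : ℝ) : Prop := ∀ i, B.side i = s

/-- The volume of a finite collection of bricks. -/
noncomputable def totalVol (𝓑 : Finset (Brick d)) : ℝ := ∑ B ∈ 𝓑, B.vol

/-- The weighted surface area of a finite collection of bricks. -/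
noncomputable def totalSurf (δ : ℝ) (𝓑 : Finset (Brick d)) : ℝ := ∑ B ∈ 𝓑, B.surf δ

/-- The bricks `Q i`, `i ∈ I`, form a packing: their interiors are pairwise disjoint. -/
def IsPacking {ι : Type*} (I : Set ι) (Q : ι → Brick d) : Prop :=
  I.Pairwise fun i j => Disjoint (interior (Q i).toSet) (interior (Q j).toSet)

/-- The solid `Ω` can be packed by cubes of sidelengths `s i`, `i ∈ I`. -/
def CanPackByCubes {ι : Type*} (Ω : Set (Fin d → ℝ)) (I : Set ι) (s : ι → ℝ) : Prop :=
  ∃ Q : ι → Brick d, (∀ i ∈ I, (Q i).IsCube (s i)) ∧ IsPacking I Q ∧ ∀ i ∈ I, (Q i).toSet ⊆ Ω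

end Brick

/-! The cubes are packed greedily in batches. The invariant `IsAdmissible` says that the free space
is cut into boxes whose volume is exactly the tail `∑_{n ≥ n₀} n^(-dt)` and whose weighted surface
is at most `A ∑_{n < n₀} n^(-e)`, where `e = (d-1)t + δt < 1` and `A` has order `M^(-(1-δ/2))`. If
every box had a side below `M n₀^(-t)`, the volume would be at most `(M n₀^(-t))^(1-δ)` times the
weighted surface, hence of order `M^(-δ/2) n₀^(1-dt)`, which is less than the tail for large `M`. So
some box is wide in all directions (`exists_wide`).

In a wide box, a one-layer grid of mesh `n₀^(-t)` receives the next `K` cubes, one per cell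
(`step`). Since sides are bounded and `(d-1)t < 1`, `K ≤ η n₀`, so each cube nearly fills its cell.
The long remainder of the box has no more weighted surface than the box itself. The other debris
costs, per cube and in units of `n₀^(-e)`, about `η^δ` for slivers inside cells and `1/M` for slabs
beside the grid. Both are small against `A`: `1/M` because of the exponent `1-δ/2`, and `η` because
it is chosen after `M`. The surface budget grows by at least `A K n₀^(-e) / 2`, which pays for the
debris and restores the invariant at `n₀ + K`. -/

/-- A closed axis-parallel box, given by its two extreme corners; it may be degenerate. -/
structure AxisBox (d : ℕ) where
  lower : Fin d → ℝ
  upper : Fin d → ℝ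

/-! ### Boxes, coordinate separation and corner cuts. -/

namespace AxisBox

variable {d : ℕ}

/-- The sidelengths of a box. -/
def side (B : AxisBox d) (i : Fin d) : ℝ := B.upper i - B.lower i

/-- The volume of a box. -/
def vol (B : AxisBox d) : ℝ := ∏ i, B.side i

/-- `B` is contained in `C`, coordinate by coordinate. -/
def Inside (B C : AxisBox d) : Prop := ∀ i, C.lower i ≤ B.lower i ∧ B.upper i ≤ C.upper i

/-- Two boxes are separated by a coordinate hyperplane. -/
def Sep (B C : AxisBox d) : Prop := ∃ i, B.upper i ≤ C.lower i ∨ C.upper i ≤ B.lower i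

/-- The cube with lower corner `a` and sidelength `s`. -/
def cube (a : Fin d → ℝ) (s : ℝ) : AxisBox d := ⟨a, fun i => a i + s⟩

/-- The sub-box with sidelengths `p` at the lower corner. -/
def corner (B : AxisBox d) (p : Fin d → ℝ) : AxisBox d := ⟨B.lower, fun i => B.lower i + p i⟩

/-- The complement of `B.corner p` in `B` is cut into the boxes `B.rest p i`. -/
def rest (B : AxisBox d) (p : Fin d → ℝ) (i : Fin d) : AxisBox d :=
  ⟨fun l => if l = i then B.lower l + p l else B.lower l,
   fun l => if l < i then B.lower l + p l else B.upper l⟩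

/-- The cells of the grid of mesh `s` at the lower corner of `B`. -/
def cell (B : AxisBox d) (s : ℝ) {k : Fin d → ℕ} (c : ∀ i, Fin (k i)) : AxisBox d :=
  cube (fun i => B.lower i + (c i : ℕ) * s) s

lemma Inside.refl (B : AxisBox d) : B.Inside B := fun _ => ⟨le_rfl, le_rfl⟩

lemma Inside.trans {A B C : AxisBox d} (h : A.Inside B) (h' : B.Inside C) : A.Inside C :=
  fun i => ⟨(h' i).1.trans (h i).1, (h i).2.trans (h' i).2⟩

lemma Inside.side_le {A B : AxisBox d} (h : A.Inside B) (i : Fin d) : A.side i ≤ B.side i :=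
  sub_le_sub (h i).2 (h i).1

lemma Sep.symm {B C : AxisBox d} (h : B.Sep C) : C.Sep B := by
  obtain ⟨i, h⟩ := h
  exact ⟨i, h.symm⟩

lemma Sep.mono {A B A' B' : AxisBox d} (h : A'.Sep B') (hA : A.Inside A') (hB : B.Inside B') :
    A.Sep B := by
  obtain ⟨i, h⟩ := h
  refine ⟨i, h.imp (fun h => ?_) (fun h => ?_)⟩
  · exact (hA i).2.trans (h.trans (hB i).1)
  · exact (hB i).2.trans (h.trans (hA i).1)

@[simp] lemma cube_side (a : Fin d → ℝ) (s : ℝ) (i : Fin d) : (cube a s).side i = s := by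
  simp [cube, side]

@[simp] lemma cell_side (B : AxisBox d) (s : ℝ) {k : Fin d → ℕ} (c : ∀ i, Fin (k i))
    (i : Fin d) : (B.cell s c).side i = s := by
  simp [cell]

lemma rest_side (B : AxisBox d) (p : Fin d → ℝ) (i l : Fin d) :
    (B.rest p i).side l = if l < i then p l else if l = i then B.side l - p l else B.side l := by
  rcases lt_trichotomy l i with h | h | h
  · simp [rest, side, h, h.ne]
  · subst h
    simp [rest, side]
    ring
  · simp [rest, side, h.ne', h.not_gt]

lemma corner_inside {B : AxisBox d} {p : Fin d → ℝ} (hp : ∀ i, p i ≤ B.side i) :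
    (B.corner p).Inside B := fun i => by
  have := hp i
  simp only [side, corner] at *
  exact ⟨le_rfl, by linarith⟩

lemma rest_inside {B : AxisBox d} {p : Fin d → ℝ} (hp₀ : ∀ i, 0 ≤ p i)
    (hp : ∀ i, p i ≤ B.side i) (i : Fin d) : (B.rest p i).Inside B := fun l => by
  have h₀ := hp₀ l
  have h₁ := hp l
  simp only [side, rest] at *
  constructor <;> split_ifs <;> linarith

lemma rest_side_nonneg {B : AxisBox d} {p : Fin d → ℝ} (hp₀ : ∀ i, 0 ≤ p i)
    (hp : ∀ i, p i ≤ B.side i) (i l : Fin d) : 0 ≤ (B.rest p i).side l := by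
  have h₀ := hp₀ l
  have h₁ := hp l
  rw [rest_side]
  split_ifs <;> linarith

lemma corner_sep_rest (B : AxisBox d) (p : Fin d → ℝ) (i : Fin d) :
    (B.corner p).Sep (B.rest p i) :=
  ⟨i, Or.inl (by simp [corner, rest])⟩

lemma rest_sep_rest (B : AxisBox d) (p : Fin d → ℝ) {i j : Fin d} (h : i ≠ j) :
    (B.rest p i).Sep (B.rest p j) := by
  rcases lt_or_gt_of_ne h with h | h
  · exact ⟨i, Or.inr (by simp [rest, h])⟩
  · exact ⟨j, Or.inl (by simp [rest, h])⟩

/-- Telescoping of `∏ side - ∏ p`, replacing `side` by `p` one coordinate at a time: `rest p i` is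
already cut to `p` before `i` and still full after `i`. -/
lemma prod_rest_side (B : AxisBox d) (p : Fin d → ℝ) :
    ∑ i, (B.rest p i).vol = B.vol - ∏ i, p i := by
  have h := Finset.prod_sub_ordered (Finset.univ : Finset (Fin d)) B.side
    (fun i => B.side i - p i)
  simp only [sub_sub_cancel] at h
  rw [h, vol, sub_sub_cancel]
  refine Finset.sum_congr rfl fun i _ => ?_
  have hsplit : (Finset.univ : Finset (Fin d)) =
      insert i (Finset.univ.filter (· < i) ∪ Finset.univ.filter (i < ·)) := by
    ext l
    rcases lt_trichotomy l i with h | h | h <;> simp [h]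
  rw [vol, hsplit, Finset.prod_insert (by simp), Finset.prod_union, ← hsplit, mul_assoc]
  · congr 1
    · simp [rest_side]
    · congr 1 <;> refine Finset.prod_congr rfl fun l hl => ?_
      · simp [rest_side, (Finset.mem_filter.1 hl).2]
      · have := (Finset.mem_filter.1 hl).2
        simp [rest_side, this.not_gt, this.ne']
  · rw [Finset.disjoint_filter]
    exact fun l _ h h' => absurd h h'.not_gt

lemma cell_inside_corner (B : AxisBox d) {s : ℝ} (hs : 0 ≤ s) {k : Fin d → ℕ}
    (c : ∀ i, Fin (k i)) : (B.cell s c).Inside (B.corner fun i => k i * s) := fun i => by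
  have h : ((c i : ℕ) : ℝ) + 1 ≤ k i := by exact_mod_cast (c i).2
  have h' := mul_le_mul_of_nonneg_right h hs
  have h'' : 0 ≤ ((c i : ℕ) : ℝ) * s := by positivity
  simp only [cell, cube, corner]
  constructor <;> linarith

lemma cell_sep_cell (B : AxisBox d) {s : ℝ} (hs : 0 ≤ s) {k : Fin d → ℕ}
    {c c' : ∀ i, Fin (k i)} (h : c ≠ c') : (B.cell s c).Sep (B.cell s c') := by
  obtain ⟨i, hi⟩ := Function.ne_iff.1 h
  rcases lt_or_gt_of_ne hi with hi | hi
  · have h : ((c i : ℕ) : ℝ) + 1 ≤ (c' i : ℕ) := by exact_mod_cast hi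
    have h' := mul_le_mul_of_nonneg_right h hs
    exact ⟨i, Or.inl (by simp only [cell, cube]; linarith)⟩
  · have h : ((c' i : ℕ) : ℝ) + 1 ≤ (c i : ℕ) := by exact_mod_cast hi
    have h' := mul_le_mul_of_nonneg_right h hs
    exact ⟨i, Or.inr (by simp only [cell, cube]; linarith)⟩

/-! ### Replacing one box by the debris around a grid of cubes. -/

section Refinement

variable {ι : Type} (F : ι → AxisBox d) (x₀ : ι) (s : ℝ) (k : Fin d → ℕ)
  (r : (∀ i, Fin (k i)) → ℝ)

/-- The boxes that remain of the family `F` when `F x₀` gets a grid of mesh `s` with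
`k 0 × ⋯ × k (d - 1)` cells, and the corner cube of sidelength `r c` is removed from the
cell `c`. -/
def leftover : {x // x ≠ x₀} ⊕ (Fin d ⊕ (∀ i, Fin (k i)) × Fin d) → AxisBox d
  | .inl x => F x
  | .inr (.inl i) => (F x₀).rest (fun i => k i * s) i
  | .inr (.inr (c, i)) => ((F x₀).cell s c).rest (fun _ => r c) i

/-- The cube removed from the cell `c`. -/
def removed (c : ∀ i, Fin (k i)) : AxisBox d := cube ((F x₀).cell s c).lower (r c)

variable {F x₀ s k r}

lemma removed_inside_cell (hr : ∀ c, r c ≤ s) (c : ∀ i, Fin (k i)) :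
    (removed F x₀ s k r c).Inside ((F x₀).cell s c) :=
  corner_inside (p := fun _ => r c) (fun _ => by simpa using hr c)

lemma cell_inside (hs : 0 ≤ s) (hk : ∀ i, k i * s ≤ (F x₀).side i) (c : ∀ i, Fin (k i)) :
    ((F x₀).cell s c).Inside (F x₀) :=
  (cell_inside_corner _ hs c).trans (corner_inside hk)

lemma removed_sep_removed (hs : 0 ≤ s) (hr : ∀ c, r c ≤ s) {c c' : ∀ i, Fin (k i)}
    (h : c ≠ c') : (removed F x₀ s k r c).Sep (removed F x₀ s k r c') :=
  (cell_sep_cell _ hs h).mono (removed_inside_cell hr c) (removed_inside_cell hr c')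

lemma cell_rest_inside (hr₀ : ∀ c, 0 ≤ r c) (hr : ∀ c, r c ≤ s) (c : ∀ i, Fin (k i))
    (i : Fin d) : (((F x₀).cell s c).rest (fun _ => r c) i).Inside ((F x₀).cell s c) :=
  rest_inside (fun _ => hr₀ c) (fun _ => by simpa using hr c) i

lemma leftover_inside (hs : 0 ≤ s) (hk : ∀ i, k i * s ≤ (F x₀).side i)
    (hr₀ : ∀ c, 0 ≤ r c) (hr : ∀ c, r c ≤ s) (y) :
    ∃ x, (leftover F x₀ s k r y).Inside (F x) := by
  rcases y with x | i | ⟨c, i⟩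
  · exact ⟨x, Inside.refl _⟩
  · exact ⟨x₀, rest_inside (fun i => by positivity) hk i⟩
  · exact ⟨x₀, (cell_rest_inside hr₀ hr c i).trans (cell_inside hs hk c)⟩

lemma leftover_side_nonneg (hF : ∀ x i, 0 ≤ (F x).side i) (hs : 0 ≤ s)
    (hk : ∀ i, k i * s ≤ (F x₀).side i) (hr₀ : ∀ c, 0 ≤ r c) (hr : ∀ c, r c ≤ s) (y) (i) :
    0 ≤ (leftover F x₀ s k r y).side i := by
  rcases y with x | j | ⟨c, j⟩
  · exact hF x i
  · exact rest_side_nonneg (fun i => by positivity) hk j i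
  · exact rest_side_nonneg (fun _ => hr₀ c) (fun _ => by simpa using hr c) j i

lemma removed_sep_leftover (hsep : Pairwise fun x y => (F x).Sep (F y)) (hs : 0 ≤ s)
    (hk : ∀ i, k i * s ≤ (F x₀).side i)
    (hr₀ : ∀ c, 0 ≤ r c) (hr : ∀ c, r c ≤ s) (c : ∀ i, Fin (k i)) (y) :
    (removed F x₀ s k r c).Sep (leftover F x₀ s k r y) := by
  have hc := removed_inside_cell (F := F) (x₀ := x₀) hr c
  rcases y with x | j | ⟨c', j⟩
  · exact (hsep x.2.symm).mono (hc.trans (cell_inside hs hk c)) (Inside.refl _)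
  · exact (corner_sep_rest _ _ j).mono (hc.trans (cell_inside_corner _ hs c)) (Inside.refl _)
  · rcases eq_or_ne c c' with rfl | h
    · exact corner_sep_rest _ (fun _ => r c) j
    · exact (cell_sep_cell _ hs h).mono hc (cell_rest_inside hr₀ hr c' j)

lemma leftover_sep (hsep : Pairwise fun x y => (F x).Sep (F y)) (hs : 0 ≤ s)
    (hk : ∀ i, k i * s ≤ (F x₀).side i)
    (hr₀ : ∀ c, 0 ≤ r c) (hr : ∀ c, r c ≤ s) :
    Pairwise fun y y' => (leftover F x₀ s k r y).Sep (leftover F x₀ s k r y') := by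
  have hout : ∀ (x : {x // x ≠ x₀}) (z), (leftover F x₀ s k r (.inl x)).Sep
      (leftover F x₀ s k r (.inr z)) := by
    rintro x (i | ⟨c, i⟩)
    · exact (hsep x.2).mono (Inside.refl _) (rest_inside (fun i => by positivity) hk i)
    · exact (hsep x.2).mono (Inside.refl _)
        ((cell_rest_inside hr₀ hr c i).trans (cell_inside hs hk c))
  have hmid : ∀ i c j, (leftover F x₀ s k r (.inr (.inl i))).Sep
      (leftover F x₀ s k r (.inr (.inr (c, j)))) := fun i c j =>
    (corner_sep_rest (F x₀) _ i).symm.mono (Inside.refl _)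
      ((cell_rest_inside hr₀ hr c j).trans (cell_inside_corner _ hs c))
  rintro (x | i | ⟨c, i⟩) (x' | i' | ⟨c', i'⟩) h
  · exact hsep (fun h' => h (by rw [Subtype.ext h']))
  · exact hout _ _
  · exact hout _ _
  · exact (hout _ _).symm
  · exact rest_sep_rest _ _ (fun h' => h (by rw [h']))
  · exact hmid _ _ _
  · exact (hout _ _).symm
  · exact (hmid _ _ _).symm
  · rcases eq_or_ne c c' with rfl | hc
    · exact rest_sep_rest _ _ (fun h' => h (by rw [h']))
    · exact (cell_sep_cell (F x₀) hs hc).mono (cell_rest_inside hr₀ hr c i)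
        (cell_rest_inside hr₀ hr c' i')

lemma sum_leftover [Fintype ι] [DecidableEq ι] (f : AxisBox d → ℝ) :
    ∑ y, f (leftover F x₀ s k r y) = (∑ x, f (F x) - f (F x₀)) +
      (∑ i, f ((F x₀).rest (fun i => k i * s) i) +
        ∑ c, ∑ i, f (((F x₀).cell s c).rest (fun _ => r c) i)) := by
  rw [Fintype.sum_sum_type, Fintype.sum_sum_type, Fintype.sum_prod_type,
    ← Fintype.sum_subtype_add_sum_subtype (fun x => x ≠ x₀) (fun x => f (F x))]
  have : ∑ x : {x // ¬ x ≠ x₀}, f (F x) = f (F x₀) := by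
    have hu : ∀ x : {x // ¬ x ≠ x₀}, f (F x) = f (F x₀) := fun x => by
      rw [not_not.1 x.2]
    simp [hu]
  rw [this, add_sub_cancel_right]
  rfl

lemma sum_vol_leftover [Fintype ι] [DecidableEq ι] :
    ∑ y, (leftover F x₀ s k r y).vol = ∑ x, (F x).vol - ∑ c, r c ^ d := by
  rw [sum_leftover vol, prod_rest_side]
  simp only [prod_rest_side, Finset.sum_sub_distrib]
  have h : ∑ c : (∀ i, Fin (k i)), ((F x₀).cell s c).vol = ∏ i, ((k i : ℝ) * s) := by
    simp [vol, Finset.prod_mul_distrib, Fintype.card_pi]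
  rw [h]
  simp

end Refinement

lemma Sep.disjoint_interior {B C : AxisBox d} (h : B.Sep C) :
    Disjoint (interior (Set.Icc B.lower B.upper)) (interior (Set.Icc C.lower C.upper)) := by
  obtain ⟨i, h⟩ := h
  simp only [← Set.pi_univ_Icc, interior_pi_set Set.finite_univ, interior_Icc]
  rw [Set.disjoint_left]
  intro z hz hz'
  have h₁ := hz i trivial
  have h₂ := hz' i trivial
  rcases h with h | h
  · exact absurd (h₁.2.trans_le h) h₂.1.not_gt
  · exact absurd (h₂.2.trans_le h) h₁.1.not_gt

end AxisBox

/-- The brick `B`, as a box. -/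
def Brick.toAxisBox {d : ℕ} (B : Brick d) : AxisBox d := ⟨B.lower, B.upper⟩

/-- Without a separating coordinate, the open side intervals overlap in every direction, because
bricks are nondegenerate; a choice of points gives a common interior point. Unlike disjoint
interiors, separation passes to sub-boxes without any case for degenerate ones. -/
lemma Brick.toAxisBox_sep {d : ℕ} {B C : Brick d}
    (h : Disjoint (interior B.toSet) (interior C.toSet)) :
    B.toAxisBox.Sep C.toAxisBox := by
  by_contra hne
  simp only [AxisBox.Sep, Brick.toAxisBox, not_exists, not_or, not_le] at hne
  have hz : ∀ i, ∃ z, max (B.lower i) (C.lower i) < z ∧ z < min (B.upper i) (C.upper i) :=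
    fun i => exists_between (max_lt (lt_min (B.lower_lt_upper i) (hne i).2)
      (lt_min (hne i).1 (C.lower_lt_upper i)))
  choose z hz using hz
  simp only [max_lt_iff, lt_min_iff] at hz
  simp only [Brick.toSet, ← Set.pi_univ_Icc, interior_pi_set Set.finite_univ,
    interior_Icc] at h
  refine (Set.disjoint_left.1 h : ∀ ⦃z⦄, _ → _) (show z ∈ _ from fun i _ => ⟨(hz i).1.1, (hz i).2.1⟩)
    (fun i _ => ⟨(hz i).1.2, (hz i).2.2⟩)

/-- A symmetric form of the weighted surface area of a box with sidelengths `x`. -/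
noncomputable def weightedSurf {d : ℕ} (δ : ℝ) (x : Fin d → ℝ) : ℝ :=
  ∑ j, x j ^ δ * ∏ l ∈ Finset.univ.erase j, x l

/-! ### Weighted surface against volume, and the cost of debris. -/

section WeightedSurf

variable {d : ℕ} {δ : ℝ} {x y : Fin d → ℝ}

lemma weightedSurf_mono (hδ : 0 ≤ δ) (hx : ∀ i, 0 ≤ x i) (hxy : ∀ i, x i ≤ y i) :
    weightedSurf δ x ≤ weightedSurf δ y :=
  Finset.sum_le_sum fun j _ => mul_le_mul (Real.rpow_le_rpow (hx j) (hxy j) hδ)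
    (Finset.prod_le_prod (fun i _ => hx i) fun i _ => hxy i)
    (Finset.prod_nonneg fun i _ => hx i) (Real.rpow_nonneg ((hx j).trans (hxy j)) _)

lemma prod_eq_rpow_mul (hx : ∀ i, 0 ≤ x i) (j : Fin d) :
    ∏ i, x i = x j ^ (1 - δ) * (x j ^ δ * ∏ l ∈ Finset.univ.erase j, x l) := by
  rw [← mul_assoc, ← Real.rpow_add' (hx j) (by simp), sub_add_cancel, Real.rpow_one,
    Finset.mul_prod_erase _ _ (Finset.mem_univ j)]

/-- A thin box has little volume relative to its weighted surface: the volume is `x j ^ (1 - δ)`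
times the `j`-th summand. -/
lemma prod_le_rpow_mul_weightedSurf (hδ : δ ≤ 1) (hx : ∀ i, 0 ≤ x i) {j : Fin d} {T : ℝ}
    (hj : x j ≤ T) : ∏ i, x i ≤ T ^ (1 - δ) * weightedSurf δ x := by
  rw [prod_eq_rpow_mul (δ := δ) hx j]
  have hnn : ∀ j, 0 ≤ x j ^ δ * ∏ l ∈ Finset.univ.erase j, x l := fun j =>
    mul_nonneg (Real.rpow_nonneg (hx j) _) (Finset.prod_nonneg fun i _ => hx i)
  exact mul_le_mul (Real.rpow_le_rpow (hx j) hj (by linarith))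
    (Finset.single_le_sum (f := fun j => x j ^ δ * ∏ l ∈ Finset.univ.erase j, x l)
      (fun j _ => hnn j) (Finset.mem_univ j)) (hnn j)
    (Real.rpow_nonneg ((hx j).trans hj) _)

/-- Passing to a majorant `y` bounded below allows degenerate `x`; each summand for `y` is `y j ^ (δ
- 1) * ∏ y`, and the exponent is nonpositive. -/
lemma weightedSurf_le (hδ₀ : 0 ≤ δ) (hδ : δ ≤ 1) {m : ℝ} (hm : 0 < m) (hx : ∀ i, 0 ≤ x i)
    (hxy : ∀ i, x i ≤ y i) (hy : ∀ i, m ≤ y i) :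
    weightedSurf δ x ≤ d * (m ^ (δ - 1) * ∏ i, y i) := by
  refine (weightedSurf_mono hδ₀ hx hxy).trans ?_
  have hy₀ : ∀ i, 0 < y i := fun i => hm.trans_le (hy i)
  have h : ∀ j ∈ (Finset.univ : Finset (Fin d)),
      y j ^ δ * ∏ l ∈ Finset.univ.erase j, y l ≤ m ^ (δ - 1) * ∏ i, y i := by
    intro j _
    have : y j ^ δ = y j ^ (δ - 1) * y j := by
      rw [← Real.rpow_add_one (hy₀ j).ne', sub_add_cancel]
    rw [this, mul_assoc, Finset.mul_prod_erase _ _ (Finset.mem_univ j)]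
    exact mul_le_mul_of_nonneg_right
      (Real.rpow_le_rpow_of_nonpos hm (hy j) (by linarith))
      (Finset.prod_nonneg fun i _ => (hy₀ i).le)
  simpa [weightedSurf] using Finset.sum_le_card_nsmul _ _ _ h

lemma weightedSurf_rest_cube_le (hδ₀ : 0 ≤ δ) (hδ : δ ≤ 1) {B : AxisBox d} {s r η : ℝ}
    (hs : 0 < s) (hη : 0 < η) (hη₁ : η ≤ 1) (hr₀ : 0 ≤ r) (hr : r ≤ s) (hrη : s - r ≤ η * s)
    (hB : ∀ i, B.side i = s) (i : Fin d) :
    weightedSurf δ (B.rest (fun _ => r) i).side ≤ d * (η ^ δ * s ^ ((d : ℝ) - 1 + δ)) := by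
  have hηs : η * s ≤ s := by nlinarith
  refine (weightedSurf_le hδ₀ hδ (m := η * s) (y := fun l => if l = i then η * s else s)
    (by positivity) (AxisBox.rest_side_nonneg (fun _ => hr₀) (fun l => by rw [hB]; exact hr) i)
    (fun l => ?_) (fun l => ?_)).trans_eq ?_
  · simp only [AxisBox.rest_side, hB]
    rcases eq_or_ne l i with rfl | h
    · simpa using hrη
    · simp only [h, if_false]
      split_ifs <;> simp [hr]
  · split_ifs <;> simp [hηs]
  · have h : ∏ l : Fin d, (if l = i then η * s else s) = η * s ^ d := by
      have : ∀ l : Fin d, (if l = i then η * s else s) = (if l = i then η else 1) * s :=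
        fun l => by split_ifs <;> simp
      rw [Finset.prod_congr rfl fun l _ => this l, Finset.prod_mul_distrib]
      simp
    rw [h, Real.mul_rpow hη.le hs.le, ← Real.rpow_natCast]
    congr 1
    have h₁ : η ^ δ = η ^ (δ - 1) * η := by
      rw [← Real.rpow_add_one hη.ne', sub_add_cancel]
    have h₂ : s ^ ((d : ℝ) - 1 + δ) = s ^ (δ - 1) * s ^ (d : ℝ) := by
      rw [← Real.rpow_add hs]; ring_nf
    rw [h₁, h₂]
    ring

/-- The weighted surface area left over by a grid of mesh `s` in a direction `i` other than the
first one, when the box is less than one mesh longer than the grid in all these directions. -/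
lemma weightedSurf_rest_le (hδ₀ : 0 ≤ δ) (hδ : δ ≤ 1) {B : AxisBox d} {s M : ℝ}
    (hs : 0 < s) (hM : 0 < M) {k : Fin d → ℕ} {i₀ i : Fin d} (hi₀ : ∀ i, i₀ ≤ i)
    (hi : i ≠ i₀) (hkM : M ≤ 2 * k i) (hk₁ : ∀ i, 1 ≤ k i)
    (hk : ∀ i, k i * s ≤ B.side i) (hk' : ∀ i, i ≠ i₀ → B.side i ≤ (k i + 1) * s) :
    weightedSurf δ (B.rest (fun i => k i * s) i).side ≤
      d * (2 ^ (d + 1) / M * (∏ i, (k i : ℝ)) * s ^ ((d : ℝ) - 1 + δ)) := by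
  have hk1 : ∀ l, (1 : ℝ) ≤ k l := fun l => by exact_mod_cast hk₁ l
  refine (weightedSurf_le hδ₀ hδ (m := s)
    -- The slab is at most one mesh thick in direction `i`, so the factor `k i ≥ M / 2` is missing
    -- from its size; this is the gain `1 / M`. As `i₀` is cut first, the slab does not see the
    -- uncontrolled length of the box in that direction.
    (y := fun l => (if l = i then (1 : ℝ) else 2 * k l) * s)
    hs (AxisBox.rest_side_nonneg (fun l => by positivity) hk i)
    (fun l => ?_) (fun l => ?_)).trans ?_
  · have h₀ := hk l
    have h' := hk' l
    have h₁ := hk1 l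
    rw [AxisBox.rest_side]
    rcases lt_trichotomy l i with h | rfl | h
    · simp only [h, if_true, h.ne, if_false]
      nlinarith
    · have := h' hi
      simp only [lt_irrefl, if_false, if_true]
      linarith
    · have := h' ((hi₀ i).trans_lt h).ne'
      simp only [h.not_gt, h.ne', if_false]
      nlinarith
  · have h₁ := hk1 l
    split_ifs <;> nlinarith
  · have h₂ : s ^ ((d : ℝ) - 1 + δ) = s ^ (δ - 1) * s ^ d := by
      rw [← Real.rpow_natCast, ← Real.rpow_add hs]; ring_nf
    rw [h₂, Finset.prod_mul_distrib]
    have hle : ∏ l : Fin d, (if l = i then (1 : ℝ) else 2 * k l) ≤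
        2 ^ (d + 1) / M * ∏ l, (k l : ℝ) := by
      have e₁ : ∏ l : Fin d, (if l = i then (1 : ℝ) else 2 * k l) =
          ∏ l ∈ Finset.univ.erase i, (2 * (k l : ℝ)) := by
        rw [← Finset.mul_prod_erase _ _ (Finset.mem_univ i)]
        simp only [if_true, one_mul]
        exact Finset.prod_congr rfl fun l hl => if_neg (Finset.ne_of_mem_erase hl)
      have e₂ : ∏ l, (k l : ℝ) = k i * ∏ l ∈ Finset.univ.erase i, (k l : ℝ) :=
        (Finset.mul_prod_erase _ _ (Finset.mem_univ i)).symm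
      rw [e₁, e₂, Finset.prod_mul_distrib, Finset.prod_const]
      set P := ∏ l ∈ Finset.univ.erase i, (k l : ℝ) with hP
      have hP0 : 0 ≤ P := Finset.prod_nonneg fun _ _ => by positivity
      have hc : (2 : ℝ) ^ (Finset.univ.erase i).card ≤ 2 ^ d :=
        pow_le_pow_right₀ (by norm_num) (by simp)
      have h3 : (2 : ℝ) ^ d ≤ 2 ^ (d + 1) / M * k i := by
        rw [div_mul_eq_mul_div, le_div_iff₀ hM, pow_succ, mul_assoc]
        exact mul_le_mul_of_nonneg_left hkM (by positivity)
      calc _ ≤ 2 ^ d * P := mul_le_mul_of_nonneg_right hc hP0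
        _ ≤ (2 ^ (d + 1) / M * k i) * P := mul_le_mul_of_nonneg_right h3 hP0
        _ = _ := by ring
    have hs' : 0 ≤ s ^ (δ - 1) * s ^ d := by positivity
    have := mul_le_mul_of_nonneg_right hle hs'
    refine mul_le_mul_of_nonneg_left (le_of_eq_of_le ?_ this) (Nat.cast_nonneg d)
    simp
    ring

end WeightedSurf

namespace Brick

variable {d : ℕ}

lemma side_pos (B : Brick d) (i : Fin d) : 0 < B.side i := sub_pos.2 (B.lower_lt_upper i)

lemma prod_side (B : Brick d) : ∏ i, B.side i = B.vol :=
  (Equiv.prod_comp (Tuple.sort B.side) B.side).symm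

lemma side_le_of_w_le {B : Brick d} {C : ℝ} (h : ∀ i, B.w i ≤ C) (i : Fin d) : B.side i ≤ C := by
  simpa [w] using h ((Tuple.sort B.side).symm i)

/-- Since `δ ≤ 1`, the largest of the `d` summands is the one that weights the shortest side. -/
lemma weightedSurf_side_le [NeZero d] {δ : ℝ} (hδ : δ ≤ 1) (B : Brick d) :
    weightedSurf δ B.side ≤ d * B.surf δ := by
  have hw₀ : 0 < B.w 0 := B.side_pos _
  have hsurf : B.surf δ = B.w 0 ^ (δ - 1) * ∏ i, B.side i := by
    rw [prod_side, vol, surf, ← Finset.mul_prod_erase _ _ (Finset.mem_univ (0 : Fin d)),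
      ← Finset.mul_prod_erase _ B.w (Finset.mem_univ (0 : Fin d)), ← mul_assoc,
      ← Real.rpow_add_one hw₀.ne', sub_add_cancel]
    simp only [Fin.val_zero, if_true]
    congr 1
    refine Finset.prod_congr rfl fun i hi => if_neg fun h => Finset.ne_of_mem_erase hi ?_
    exact Fin.ext (by simpa using h)
  have hmin : ∀ i, B.w 0 ≤ B.side i := fun i => by
    have := Tuple.monotone_sort B.side (Fin.zero_le ((Tuple.sort B.side).symm i))
    simpa [w] using this
  rw [hsurf]
  have h : ∀ j ∈ (Finset.univ : Finset (Fin d)),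
      B.side j ^ δ * ∏ l ∈ Finset.univ.erase j, B.side l ≤
        B.w 0 ^ (δ - 1) * ∏ i, B.side i := by
    intro j _
    have : B.side j ^ δ = B.side j ^ (δ - 1) * B.side j := by
      rw [← Real.rpow_add_one (B.side_pos j).ne', sub_add_cancel]
    rw [this, mul_assoc, Finset.mul_prod_erase _ _ (Finset.mem_univ j)]
    exact mul_le_mul_of_nonneg_right
      (Real.rpow_le_rpow_of_nonpos hw₀ (hmin j) (by linarith))
      (Finset.prod_nonneg fun i _ => (B.side_pos i).le)
  simpa [weightedSurf] using Finset.sum_le_card_nsmul _ _ _ h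

end Brick

/-! ### Elementary estimates for sums of powers. -/

section PowerSums

lemma sum_rpow_neg_le {e : ℝ} (he₀ : 0 ≤ e) (he : e < 1) (n : ℕ) :
    ∑ k ∈ Finset.Ico 1 (n + 1), 1 / (k : ℝ) ^ e ≤ (n : ℝ) ^ (1 - e) / (1 - e) := by
  have he' : 0 < 1 - e := by linarith
  induction n with
  | zero => simpa using div_nonneg (Real.rpow_nonneg le_rfl _) he'.le
  | succ n ih =>
    rw [Finset.sum_Ico_succ_top (by omega)]
    set N : ℝ := ((n + 1 : ℕ) : ℝ) with hN
    have hN0 : 0 < N := by positivity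
    have hn : (n : ℝ) = N * (1 + -(1 / N)) := by
      rw [mul_add, mul_neg, mul_one_div_cancel hN0.ne', hN]; push_cast; ring
    have h1 : 1 / N ≤ 1 := by
      rw [div_le_one hN0, hN]; push_cast; linarith [n.cast_nonneg (α := ℝ)]
    -- Bernoulli's inequality for the concave power `1 - e` replaces the comparison with an
    -- integral.
    have hb := rpow_one_add_le_one_add_mul_self (s := -(1 / N)) (by linarith)
      he'.le (by linarith : 1 - e ≤ 1)
    have hNe : N ^ (1 - e) = N * (1 / N ^ e) := by
      rw [Real.rpow_sub hN0, Real.rpow_one]; ring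
    have key : (n : ℝ) ^ (1 - e) ≤ N ^ (1 - e) - (1 - e) * (1 / N ^ e) := by
      rw [hn, Real.mul_rpow hN0.le (by linarith)]
      refine (mul_le_mul_of_nonneg_left hb (by positivity)).trans_eq ?_
      rw [hNe]
      field_simp
      ring
    rw [le_div_iff₀ he'] at ih ⊢
    nlinarith

/-- The first `n₀` terms suffice, each being at least `(2 n₀)^(-p)`. -/
lemma le_tsum_rpow {p : ℝ} (hp : 1 < p) {n₀ : ℕ} (hn₀ : 1 ≤ n₀) :
    2 ^ (-p) * (n₀ : ℝ) ^ (1 - p) ≤ ∑' k : ℕ, 1 / ((n₀ + k : ℕ) : ℝ) ^ p := by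
  have hn : (0 : ℝ) < n₀ := by exact_mod_cast hn₀
  have hs : Summable fun k : ℕ => 1 / ((n₀ + k : ℕ) : ℝ) ^ p := by
    simpa [add_comm] using (summable_nat_add_iff n₀).2 (Real.summable_one_div_nat_rpow.2 hp)
  refine le_trans ?_ (hs.sum_le_tsum (Finset.range n₀) fun _ _ => by positivity)
  have h : ∀ k ∈ Finset.range n₀, 2 ^ (-p) * (n₀ : ℝ) ^ (-p) ≤
      1 / ((n₀ + k : ℕ) : ℝ) ^ p := by
    intro k hk
    have hk' : (k : ℝ) ≤ n₀ := by exact_mod_cast (Finset.mem_range.1 hk).le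
    rw [← Real.mul_rpow (by norm_num) hn.le, one_div, ← Real.rpow_neg (by positivity)]
    refine Real.rpow_le_rpow_of_nonpos ?_ ?_ (by linarith)
    · push_cast; positivity
    · push_cast; linarith
  have := Finset.card_nsmul_le_sum _ _ _ h
  refine le_of_eq_of_le ?_ this
  rw [Finset.card_range, nsmul_eq_mul, sub_eq_add_neg, Real.rpow_add hn, Real.rpow_one]
  ring

lemma tsum_rpow_eq_add {p : ℝ} (hp : 1 < p) (n₀ K : ℕ) :
    ∑' k : ℕ, 1 / ((n₀ + k : ℕ) : ℝ) ^ p = ∑ k ∈ Finset.range K, 1 / ((n₀ + k : ℕ) : ℝ) ^ p +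
      ∑' k : ℕ, 1 / ((n₀ + K + k : ℕ) : ℝ) ^ p := by
  have hs : Summable fun k : ℕ => 1 / ((n₀ + k : ℕ) : ℝ) ^ p := by
    simpa [add_comm] using (summable_nat_add_iff n₀).2 (Real.summable_one_div_nat_rpow.2 hp)
  rw [← hs.sum_add_tsum_nat_add K]
  simp only [add_comm, add_left_comm]

lemma le_sum_Ico_rpow {e : ℝ} (he₀ : 0 ≤ e) (he : e ≤ 1) {n₀ K : ℕ} (hn₀ : 1 ≤ n₀)
    (hK : K ≤ n₀) :
    K * (n₀ : ℝ) ^ (-e) / 2 ≤ ∑ n ∈ Finset.Ico n₀ (n₀ + K), 1 / (n : ℝ) ^ e := by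
  have hn : (0 : ℝ) < n₀ := by exact_mod_cast hn₀
  have h : ∀ n ∈ Finset.Ico n₀ (n₀ + K), (n₀ : ℝ) ^ (-e) / 2 ≤ 1 / (n : ℝ) ^ e := by
    intro n hnm
    rw [Finset.mem_Ico] at hnm
    have h1 : (n₀ : ℝ) ≤ n := by exact_mod_cast hnm.1
    have h2 : (n : ℝ) ≤ 2 * n₀ := by exact_mod_cast (by omega : n ≤ 2 * n₀)
    have h3 : (n : ℝ) ^ e ≤ 2 * (n₀ : ℝ) ^ e := by
      refine (Real.rpow_le_rpow (hn.le.trans h1) h2 he₀).trans ?_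
      rw [Real.mul_rpow (by norm_num) hn.le]
      refine mul_le_mul_of_nonneg_right ?_ (by positivity)
      simpa using Real.rpow_le_rpow_of_exponent_le (by norm_num : (1 : ℝ) ≤ 2) he
    have h4 : 0 < (n : ℝ) ^ e := Real.rpow_pos_of_pos (hn.trans_le h1) _
    rw [Real.rpow_neg hn.le, le_div_iff₀ h4, inv_eq_one_div, div_div, div_mul_eq_mul_div, one_mul,
      div_le_one (by positivity)]
    linarith
  have := Finset.card_nsmul_le_sum _ _ _ h
  refine le_of_eq_of_le ?_ this
  simp [nsmul_eq_mul]
  ring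

/-- As `t ≤ 1`, `(n₀ / n)^t ≥ n₀ / n ≥ 1 - η`: cubes of one batch have nearly equal size. -/
lemma rpow_neg_sub_le {t η : ℝ} (ht : t ≤ 1) {n₀ n : ℕ} (hn₀ : 1 ≤ n₀)
    (hn : n₀ ≤ n) (hη : (n : ℝ) - n₀ ≤ η * n₀) :
    (n₀ : ℝ) ^ (-t) - (n : ℝ) ^ (-t) ≤ η * (n₀ : ℝ) ^ (-t) := by
  have h0 : (0 : ℝ) < n₀ := by exact_mod_cast hn₀
  have h1 : (n₀ : ℝ) ≤ n := by exact_mod_cast hn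
  have h2 : 0 < (n : ℝ) := h0.trans_le h1
  have hq : (n₀ : ℝ) / n ≤ ((n₀ : ℝ) / n) ^ t := by
    simpa using Real.rpow_le_rpow_of_exponent_ge (by positivity) ((div_le_one h2).2 h1) ht
  have hq' : 1 - η ≤ (n₀ : ℝ) / n := by
    rw [le_div_iff₀ h2]
    have : 0 ≤ η := by
      by_contra hneg
      nlinarith
    nlinarith
  have he : (n : ℝ) ^ (-t) = ((n₀ : ℝ) / n) ^ t * (n₀ : ℝ) ^ (-t) := by
    rw [Real.div_rpow h0.le h2.le, Real.rpow_neg h0.le, Real.rpow_neg h2.le]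
    have := (Real.rpow_pos_of_pos h0 t).ne'
    field_simp
  have hp := Real.rpow_pos_of_pos h0 (-t)
  rw [he]
  nlinarith

end PowerSums

/-- A family of boxes whose total volume is that of the cubes of sidelength `n ^ (-t)`, `n₀ ≤ n`,
with controlled weighted surface area and bounded sidelengths. -/
structure IsAdmissible {d : ℕ} {ι : Type} [Fintype ι] (t δ A C : ℝ) (n₀ : ℕ)
    (F : ι → AxisBox d) : Prop where
  side_nonneg : ∀ x i, 0 ≤ (F x).side i
  sep : Pairwise fun x y => (F x).Sep (F y)
  vol_eq : ∑ x, (F x).vol = ∑' k : ℕ, 1 / ((n₀ + k : ℕ) : ℝ) ^ ((d : ℝ) * t)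
  surf_le : ∑ x, weightedSurf δ (F x).side ≤
    A * ∑ n ∈ Finset.Ico 1 n₀, 1 / (n : ℝ) ^ (((d : ℝ) - 1) * t + δ * t)
  side_le : ∀ x i, (F x).side i ≤ C

/-! ### One round of the greedy packing. -/

namespace IsAdmissible

variable {d : ℕ} {ι : Type} [Fintype ι] {t δ A C : ℝ} {n₀ : ℕ} {F : ι → AxisBox d}

lemma exists_wide (hF : IsAdmissible t δ A C n₀ F) (hn₀ : 1 ≤ n₀) (hδ : δ ≤ 1) (hA : 0 ≤ A)
    (hp : 1 < (d : ℝ) * t) (he₀ : 0 ≤ ((d : ℝ) - 1) * t + δ * t)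
    (he : ((d : ℝ) - 1) * t + δ * t < 1) {M : ℝ} (hM : 0 ≤ M)
    (hsel : M ^ (1 - δ) * A / (1 - (((d : ℝ) - 1) * t + δ * t)) < 2 ^ (-((d : ℝ) * t))) :
    ∃ x, ∀ i, M * (n₀ : ℝ) ^ (-t) ≤ (F x).side i := by
  by_contra! hcon
  have h0 : (0 : ℝ) < n₀ := by exact_mod_cast hn₀
  set e := ((d : ℝ) - 1) * t + δ * t with hedef
  have he' : 0 < 1 - e := by linarith
  have hT : 0 ≤ M * (n₀ : ℝ) ^ (-t) := by positivity
  have h1 : ∑ x, (F x).vol ≤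
      (M * (n₀ : ℝ) ^ (-t)) ^ (1 - δ) * ∑ x, weightedSurf δ (F x).side := by
    rw [Finset.mul_sum]
    refine Finset.sum_le_sum fun x _ => ?_
    obtain ⟨j, hj⟩ := hcon x
    exact prod_le_rpow_mul_weightedSurf hδ (hF.side_nonneg x) hj.le
  have h2 : ∑ n ∈ Finset.Ico 1 n₀, 1 / (n : ℝ) ^ e ≤ (n₀ : ℝ) ^ (1 - e) / (1 - e) := by
    obtain ⟨m, rfl⟩ : ∃ m, n₀ = m + 1 := ⟨n₀ - 1, by omega⟩
    refine (sum_rpow_neg_le he₀ he m).trans ?_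
    gcongr
    simp
  have h3 := le_tsum_rpow hp hn₀
  rw [← hF.vol_eq] at h3
  have h4 : (M * (n₀ : ℝ) ^ (-t)) ^ (1 - δ) * (A * ((n₀ : ℝ) ^ (1 - e) / (1 - e))) =
      (M ^ (1 - δ) * A / (1 - e)) * (n₀ : ℝ) ^ (1 - (d : ℝ) * t) := by
    have : (n₀ : ℝ) ^ (1 - (d : ℝ) * t) = ((n₀ : ℝ) ^ (-t)) ^ (1 - δ) * (n₀ : ℝ) ^ (1 - e) := by
      rw [← Real.rpow_mul h0.le, ← Real.rpow_add h0]
      congr 1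
      rw [hedef]
      ring
    rw [Real.mul_rpow hM (by positivity), this]
    ring
  have h5 : ∑ x, (F x).vol ≤
      (M ^ (1 - δ) * A / (1 - e)) * (n₀ : ℝ) ^ (1 - (d : ℝ) * t) := by
    rw [← h4]
    refine h1.trans (mul_le_mul_of_nonneg_left (hF.surf_le.trans ?_) (by positivity))
    exact mul_le_mul_of_nonneg_left h2 hA
  have h6 := mul_lt_mul_of_pos_right hsel (Real.rpow_pos_of_pos h0 (1 - (d : ℝ) * t))
  linarith

lemma step [NeZero d] (hF : IsAdmissible t δ A C n₀ F) (hn₀ : 1 ≤ n₀)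
    (hδ₀ : 0 < δ) (hδ : δ ≤ 1) (hA : 0 ≤ A) (ht₀ : 0 ≤ t) (ht : t ≤ 1)
    (hp : 1 < (d : ℝ) * t) (he₀ : 0 ≤ ((d : ℝ) - 1) * t + δ * t)
    (he : ((d : ℝ) - 1) * t + δ * t < 1) {M η : ℝ} (hM : 2 ≤ M) (hη₀ : 0 < η) (hη : η ≤ 1)
    (hbud : (d : ℝ) ^ 2 * η ^ δ + (d : ℝ) ^ 2 * (2 ^ (d + 1) / M) ≤ A / 2)
    (hC : (C * (n₀ : ℝ) ^ t) ^ (d - 1) ≤ η * n₀)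
    {x₀ : ι} (hx₀ : ∀ i, M * (n₀ : ℝ) ^ (-t) ≤ (F x₀).side i) :
    ∃ K : ℕ, 1 ≤ K ∧ ∃ (κ : Type) (_ : Fintype κ) (G : κ → AxisBox d) (a : ℕ → Fin d → ℝ),
      IsAdmissible t δ A C (n₀ + K) G ∧ (∀ y, ∃ x, (G y).Inside (F x)) ∧
      (∀ n ∈ Set.Ico n₀ (n₀ + K), (AxisBox.cube (a n) ((n : ℝ) ^ (-t))).Inside (F x₀) ∧
        ∀ y, (AxisBox.cube (a n) ((n : ℝ) ^ (-t))).Sep (G y)) ∧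
      (Set.Ico n₀ (n₀ + K)).Pairwise fun n m =>
        (AxisBox.cube (a n) ((n : ℝ) ^ (-t))).Sep (AxisBox.cube (a m) ((m : ℝ) ^ (-t))) := by
  classical
  have h0 : (0 : ℝ) < n₀ := by exact_mod_cast hn₀
  set s := (n₀ : ℝ) ^ (-t) with hs_def
  have hs : 0 < s := Real.rpow_pos_of_pos h0 _
  -- With a single layer in direction `0`, `K` is at most `(C n₀^t)^(d-1)`, and the remainder in
  -- that direction is charged to the old weighted surface of the box.
  let k : Fin d → ℕ := fun i => if i = 0 then 1 else ⌊(F x₀).side i / s⌋₊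
  have hside : ∀ i, M ≤ (F x₀).side i / s := fun i => (le_div_iff₀ hs).2 (hx₀ i)
  have hk : ∀ i, (k i : ℝ) * s ≤ (F x₀).side i := fun i => by
    rw [← le_div_iff₀ hs]
    by_cases h : i = 0
    · simp only [k, h, if_true]
      have := hside 0
      push_cast
      linarith
    · simp only [k, h, if_false]
      exact Nat.floor_le (by linarith [hside i])
  have hk' : ∀ i, i ≠ 0 → (F x₀).side i ≤ (k i + 1) * s := fun i h => by
    rw [← div_le_iff₀ hs]
    simp only [k, h, if_false]
    exact (Nat.lt_floor_add_one _).le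
  have hkM : ∀ i, i ≠ 0 → M ≤ 2 * k i := fun i h => by
    have h1 := (div_le_iff₀ hs).2 (hk' i h)
    have h2 := hside i
    have h3 : (1 : ℝ) ≤ k i := by
      have : 1 ≤ k i := by
        simp only [k, h, if_false]
        exact Nat.le_floor (by push_cast; linarith)
      exact_mod_cast this
    linarith
  have hk₁ : ∀ i, 1 ≤ k i := fun i => by
    by_cases h : i = 0
    · simp [k, h]
    · have h1 : (0 : ℝ) < k i := by linarith [hkM i h]
      exact_mod_cast h1
  set K := ∏ i, k i with hK
  have hK₁ : 1 ≤ K := Nat.succ_le_of_lt (Finset.prod_pos fun i _ => hk₁ i)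
  have hKη : (K : ℝ) ≤ η * n₀ := by
    refine le_trans ?_ hC
    rw [hK, ← Finset.mul_prod_erase _ _ (Finset.mem_univ (0 : Fin d))]
    simp only [k, if_true, one_mul]
    rw [Nat.cast_prod]
    have hcard : (Finset.univ.erase (0 : Fin d)).card = d - 1 := by
      simp
    rw [← hcard, ← Finset.prod_const]
    refine Finset.prod_le_prod (fun i _ => Nat.cast_nonneg _) fun i hi => ?_
    have h := Finset.ne_of_mem_erase hi
    have h1 := hk i
    simp only [k, h, if_false] at h1 ⊢
    have h2 : (C * (n₀ : ℝ) ^ t) * s = C := by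
      rw [hs_def, mul_assoc, ← Real.rpow_add h0]
      simp
    have h3 := hF.side_le x₀ i
    exact le_of_mul_le_mul_right (by linarith) hs
  have hKn : K ≤ n₀ := by
    have : (K : ℝ) ≤ n₀ := by nlinarith
    exact_mod_cast this
  -- Any assignment of cubes to cells works, as every cube of the batch has side between `(1 - η) s`
  -- and `s`.
  let φ : (∀ i, Fin (k i)) ≃ Fin K := Fintype.equivFinOfCardEq (by simp [hK])
  let r : (∀ i, Fin (k i)) → ℝ := fun c => ((n₀ + (φ c : ℕ) : ℕ) : ℝ) ^ (-t)
  have hr₀ : ∀ c, 0 ≤ r c := fun c => by positivity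
  have hr : ∀ c, r c ≤ s := fun c =>
    Real.rpow_le_rpow_of_nonpos h0 (by push_cast; linarith [(φ c : ℕ).cast_nonneg (α := ℝ)])
      (by linarith)
  have hrη : ∀ c, s - r c ≤ η * s := fun c => by
    refine rpow_neg_sub_le ht hn₀ (Nat.le_add_right _ _) ?_
    have : ((φ c : ℕ) : ℝ) ≤ K := by exact_mod_cast (φ c).2.le
    push_cast
    linarith
  have hinside := AxisBox.leftover_inside (F := F) hs.le hk hr₀ hr
  have hse : s ^ ((d : ℝ) - 1 + δ) = (n₀ : ℝ) ^ (-(((d : ℝ) - 1) * t + δ * t)) := by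
    rw [hs_def, ← Real.rpow_mul h0.le]
    ring_nf
  have hvol : ∑ c, r c ^ d =
      ∑ j ∈ Finset.range K, 1 / ((n₀ + j : ℕ) : ℝ) ^ ((d : ℝ) * t) := by
    rw [← Fin.sum_univ_eq_sum_range (fun j => 1 / ((n₀ + j : ℕ) : ℝ) ^ ((d : ℝ) * t)),
      ← φ.sum_comp]
    refine Finset.sum_congr rfl fun c _ => ?_
    have hc : (0 : ℝ) ≤ ((n₀ + (φ c : ℕ) : ℕ) : ℝ) := Nat.cast_nonneg _
    rw [one_div, ← Real.rpow_neg hc, ← Real.rpow_natCast, ← Real.rpow_mul hc]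
    ring_nf
  have hsurf : ∑ y, weightedSurf δ (AxisBox.leftover F x₀ s k r y).side ≤
      ∑ x, weightedSurf δ (F x).side +
        ((d : ℝ) ^ 2 * η ^ δ + (d : ℝ) ^ 2 * (2 ^ (d + 1) / M)) *
          (K * s ^ ((d : ℝ) - 1 + δ)) := by
    rw [AxisBox.sum_leftover (fun B => weightedSurf δ B.side)]
    have hmain : ∑ i, weightedSurf δ ((F x₀).rest (fun i => k i * s) i).side ≤
        weightedSurf δ (F x₀).side +
          d * (d * (2 ^ (d + 1) / M * K * s ^ ((d : ℝ) - 1 + δ))) := by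
      have h : ∀ i ∈ (Finset.univ : Finset (Fin d)),
          weightedSurf δ ((F x₀).rest (fun i => k i * s) i).side ≤
            (if i = 0 then weightedSurf δ (F x₀).side else 0) +
              d * (2 ^ (d + 1) / M * K * s ^ ((d : ℝ) - 1 + δ)) := by
        intro i _
        split_ifs with h
        · refine (weightedSurf_mono hδ₀.le
            (AxisBox.rest_side_nonneg (fun i => by positivity) hk i)
            (AxisBox.rest_inside (fun i => by positivity) hk i).side_le).trans ?_
          exact le_add_of_nonneg_right (by positivity)
        · have := weightedSurf_rest_le hδ₀.le hδ hs (by linarith) (fun i => Fin.zero_le i) h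
            (hkM i h) hk₁ hk hk'
          rw [zero_add, hK, Nat.cast_prod]
          exact this
      refine (Finset.sum_le_sum h).trans_eq ?_
      rw [Finset.sum_add_distrib]
      simp
    have hcell : ∑ c, ∑ i, weightedSurf δ (((F x₀).cell s c).rest (fun _ => r c) i).side ≤
        K * (d * (d * (η ^ δ * s ^ ((d : ℝ) - 1 + δ)))) := by
      have h : ∀ c ∈ (Finset.univ : Finset (∀ i, Fin (k i))),
          ∑ i, weightedSurf δ (((F x₀).cell s c).rest (fun _ => r c) i).side ≤
            d * (d * (η ^ δ * s ^ ((d : ℝ) - 1 + δ))) := fun c _ => by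
        refine (Finset.sum_le_sum fun i _ => weightedSurf_rest_cube_le hδ₀.le hδ hs hη₀ hη
          (hr₀ c) (hr c) (hrη c) (AxisBox.cell_side _ _ _) i).trans_eq ?_
        simp
      refine (Finset.sum_le_sum h).trans_eq ?_
      rw [Finset.sum_const, Finset.card_univ, Fintype.card_congr φ, Fintype.card_fin,
        nsmul_eq_mul]
    linarith
  refine ⟨K, hK₁, _, inferInstance, AxisBox.leftover F x₀ s k r,
    fun n => if h : n - n₀ < K then ((F x₀).cell s (φ.symm ⟨n - n₀, h⟩)).lower else 0,
    ⟨AxisBox.leftover_side_nonneg hF.side_nonneg hs.le hk hr₀ hr,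
      AxisBox.leftover_sep hF.sep hs.le hk hr₀ hr, ?_, ?_, fun y i => ?_⟩, hinside, ?_, ?_⟩
  · rw [AxisBox.sum_vol_leftover, hF.vol_eq, tsum_rpow_eq_add hp n₀ K, hvol,
      add_sub_cancel_left]
  · refine hsurf.trans ?_
    rw [← Finset.sum_Ico_consecutive _ hn₀ (Nat.le_add_right n₀ K), mul_add]
    refine add_le_add hF.surf_le ?_
    -- The factor `1/2` lost here is why `hbud` asks for `A / 2`.
    refine le_trans ?_ (mul_le_mul_of_nonneg_left (le_sum_Ico_rpow he₀ he.le hn₀ hKn) hA)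
    rw [← hse]
    refine (mul_le_mul_of_nonneg_right hbud (by positivity)).trans_eq ?_
    ring
  · obtain ⟨x, hx⟩ := hinside y
    exact (hx.side_le i).trans (hF.side_le x i)
  all_goals
    have hcube : ∀ n ∈ Set.Ico n₀ (n₀ + K), ∃ h : n - n₀ < K,
        AxisBox.cube (if h : n - n₀ < K then
          ((F x₀).cell s (φ.symm ⟨n - n₀, h⟩)).lower else 0) ((n : ℝ) ^ (-t)) =
          AxisBox.removed F x₀ s k r (φ.symm ⟨n - n₀, h⟩) := fun n hn => by
      have h : n - n₀ < K := by have := hn.1; have := hn.2; omega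
      refine ⟨h, ?_⟩
      have hnn : n₀ + (n - n₀) = n := Nat.add_sub_of_le hn.1
      simp only [h, dif_pos, AxisBox.removed, r, Equiv.apply_symm_apply, hnn]
  · intro n hn
    obtain ⟨h, he⟩ := hcube n hn
    rw [he]
    exact ⟨(AxisBox.removed_inside_cell hr _).trans (AxisBox.cell_inside hs.le hk _),
      AxisBox.removed_sep_leftover hF.sep hs.le hk hr₀ hr _⟩
  · intro n hn m hm hnm
    obtain ⟨h, he⟩ := hcube n hn
    obtain ⟨h', he'⟩ := hcube m hm
    simp only [he, he']
    refine AxisBox.removed_sep_removed hs.le hr fun hc => hnm ?_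
    have h1 : n - n₀ = m - n₀ := by simpa using hc
    have := hn.1
    have := hm.1
    omega

end IsAdmissible

/-- Induction on a bound `m` for the number of cubes still to place; `K ≥ 1` ensures progress. The
index type is quantified inside, since each round changes it. -/
theorem exists_packing_of_isAdmissible {d : ℕ} [NeZero d] {t δ A C M η : ℝ} {N₀ : ℕ}
    (hN₀ : 1 ≤ N₀) (hδ₀ : 0 < δ) (hδ : δ ≤ 1) (hA : 0 ≤ A) (ht₀ : 0 ≤ t) (ht : t ≤ 1)
    (hp : 1 < (d : ℝ) * t) (he₀ : 0 ≤ ((d : ℝ) - 1) * t + δ * t)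
    (he : ((d : ℝ) - 1) * t + δ * t < 1) (hM : 2 ≤ M) (hη₀ : 0 < η) (hη : η ≤ 1)
    (hsel : M ^ (1 - δ) * A / (1 - (((d : ℝ) - 1) * t + δ * t)) < 2 ^ (-((d : ℝ) * t)))
    (hbud : (d : ℝ) ^ 2 * η ^ δ + (d : ℝ) ^ 2 * (2 ^ (d + 1) / M) ≤ A / 2)
    (hC : ∀ n : ℕ, N₀ ≤ n → (C * (n : ℝ) ^ t) ^ (d - 1) ≤ η * n) (N : ℕ) :
    ∀ (m n₀ : ℕ), N₀ ≤ n₀ → N ≤ n₀ + m → ∀ (ι : Type) [Fintype ι] (F : ι → AxisBox d),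
      IsAdmissible t δ A C n₀ F → ∃ a : ℕ → Fin d → ℝ,
        (∀ n ∈ Set.Ico n₀ N, ∃ x, (AxisBox.cube (a n) ((n : ℝ) ^ (-t))).Inside (F x)) ∧
        (Set.Ico n₀ N).Pairwise fun n m =>
          (AxisBox.cube (a n) ((n : ℝ) ^ (-t))).Sep (AxisBox.cube (a m) ((m : ℝ) ^ (-t))) := by
  intro m
  induction m with
  | zero =>
    intro n₀ _ hN ι _ F _
    have : Set.Ico n₀ N = ∅ := Set.Ico_eq_empty (by omega)
    exact ⟨0, by simp [this], by simp [this]⟩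
  | succ m ih =>
    intro n₀ hn₀ hN ι _ F hF
    have hn₀' : 1 ≤ n₀ := hN₀.trans hn₀
    obtain ⟨x₀, hx₀⟩ := hF.exists_wide hn₀' hδ hA hp he₀ he (by linarith) hsel
    obtain ⟨K, hK, κ, _, G, a, hG, hGF, haF, hapair⟩ := hF.step hn₀' hδ₀ hδ hA ht₀ ht hp he₀ he hM
      hη₀ hη hbud (hC n₀ hn₀) hx₀
    obtain ⟨b, hbG, hbpair⟩ := ih (n₀ + K) (by omega) (by omega) κ G hG
    have hab : ∀ n ∈ Set.Ico n₀ (n₀ + K), ∀ l ∈ Set.Ico (n₀ + K) N,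
        (AxisBox.cube (a n) ((n : ℝ) ^ (-t))).Sep (AxisBox.cube (b l) ((l : ℝ) ^ (-t))) := by
      intro n hn l hl
      obtain ⟨y, hy⟩ := hbG l hl
      exact ((haF n hn).2 y).mono (AxisBox.Inside.refl _) hy
    refine ⟨fun n => if n < n₀ + K then a n else b n, fun n hn => ?_, fun n hn l hl hnl => ?_⟩
    · by_cases h : n < n₀ + K
      · simp only [h, if_true]
        exact ⟨x₀, (haF n ⟨hn.1, h⟩).1⟩
      · simp only [h, if_false]
        obtain ⟨y, hy⟩ := hbG n ⟨by omega, hn.2⟩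
        obtain ⟨x, hx⟩ := hGF y
        exact ⟨x, hy.trans hx⟩
    · by_cases h : n < n₀ + K <;> by_cases h' : l < n₀ + K <;> simp only [h, h', if_true, if_false]
      · exact hapair ⟨hn.1, h⟩ ⟨hl.1, h'⟩ hnl
      · exact hab n ⟨hn.1, h⟩ l ⟨by omega, hl.2⟩
      · exact (hab l ⟨hl.1, h'⟩ n ⟨by omega, hn.2⟩).symm
      · exact hbpair ⟨by omega, hn.2⟩ ⟨by omega, hl.2⟩ hnl

/-! ### Choice of constants and conclusion. -/

lemma eventually_mul_rpow_neg_lt {y : ℝ} (hy : 0 < y) (c : ℝ) {ε : ℝ} (hε : 0 < ε) :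
    ∀ᶠ x : ℝ in Filter.atTop, c * x ^ (-y) < ε := by
  have h := (tendsto_rpow_neg_atTop hy).const_mul c
  rw [mul_zero] at h
  exact h.eventually (gt_mem_nhds hε)

theorem proposition3p1 (d : ℕ) (hd : 2 ≤ d) (t δ : ℝ)
    (ht₁ : 1 / (d : ℝ) < t) (ht₂ : t < 1 / ((d : ℝ) - 1))
    (hδ₀ : 0 < δ) (hδ₁ : δ < 1) (htδ : ((d : ℝ) - 1) * t + δ * t < 1)
    (C₁ C₂ : ℝ) (hC₁ : 0 < C₁) (hC₂ : 0 < C₂) :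
    ∃ M₀ : ℝ, ∀ M : ℝ, M₀ ≤ M → ∃ N₀ : ℕ, ∀ n₀ nmax : ℕ, N₀ ≤ n₀ → n₀ ≤ nmax →
      ∀ 𝓑 : Finset (Brick d),
        Brick.IsPacking (𝓑 : Set (Brick d)) id →
        Brick.totalVol 𝓑 = ∑' k : ℕ, 1 / ((n₀ + k : ℕ) : ℝ) ^ ((d : ℝ) * t) →
        Brick.totalSurf δ 𝓑 ≤ C₁ * (1 / M ^ (1 - δ / 2) *
          ∑ n ∈ Finset.Ico 1 n₀, 1 / (n : ℝ) ^ (((d : ℝ) - 1) * t + δ * t)) →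
        (∀ B ∈ 𝓑, ∀ i, B.w i ≤ C₂) →
        Brick.CanPackByCubes (⋃ B ∈ 𝓑, B.toSet) (Set.Ico n₀ nmax) (fun n : ℕ => (n : ℝ) ^ (-t)) := by
  have : NeZero d := ⟨by omega⟩
  have hd' : (2 : ℝ) ≤ d := by exact_mod_cast hd
  have hd₀ : (0 : ℝ) < d := by linarith
  have ht₀ : 0 < t := lt_trans (by positivity) ht₁
  have ht : t * ((d : ℝ) - 1) < 1 := (lt_div_iff₀ (by linarith)).1 ht₂
  have ht' : t ≤ 1 := by nlinarith
  have hp : 1 < (d : ℝ) * t := by rwa [div_lt_iff₀' hd₀] at ht₁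
  have he₀ : 0 ≤ ((d : ℝ) - 1) * t + δ * t :=
    add_nonneg (mul_nonneg (by linarith) ht₀.le) (by positivity)
  have he' : 0 < 1 - (((d : ℝ) - 1) * t + δ * t) := by linarith
  have hδ2 : 0 < δ / 2 := by positivity
  -- The first smallness condition yields a wide box, the second bounds the slab cost by `A / 4`;
  -- each gains `M^(-δ/2)`.
  obtain ⟨M₀, hM₀⟩ := Filter.eventually_atTop.1 <| (Filter.eventually_ge_atTop (2 : ℝ)).and <|
    (eventually_mul_rpow_neg_lt hδ2 (d * C₁ / (1 - (((d : ℝ) - 1) * t + δ * t)))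
      (Real.rpow_pos_of_pos two_pos (-((d : ℝ) * t)))).and
    (eventually_mul_rpow_neg_lt hδ2 ((d : ℝ) ^ 2 * 2 ^ (d + 1))
      (by positivity : 0 < d * C₁ / 4))
  refine ⟨M₀, fun M hM => ?_⟩
  obtain ⟨hM2, hMsel, hMbud⟩ := hM₀ M hM
  have hMpos : 0 < M := by linarith
  set A := d * C₁ / M ^ (1 - δ / 2) with hA_def
  have hA : 0 < A := by positivity
  have hMA : A = d * C₁ * M ^ (δ / 2) / M := by
    rw [hA_def, Real.rpow_sub hMpos, Real.rpow_one]
    field_simp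
  obtain ⟨η, hη₀, hη₁, hη⟩ : ∃ η : ℝ, 0 < η ∧ η ≤ 1 ∧ (d : ℝ) ^ 2 * η ^ δ ≤ A / 4 := by
    have hb : 0 < A / 4 / (d : ℝ) ^ 2 := by positivity
    refine ⟨min 1 ((A / 4 / (d : ℝ) ^ 2) ^ δ⁻¹), lt_min one_pos (by positivity),
      min_le_left _ _, ?_⟩
    rw [← le_div_iff₀' (by positivity)]
    refine (Real.rpow_le_rpow (by positivity) (min_le_right _ _) hδ₀.le).trans_eq ?_
    rw [← Real.rpow_mul hb.le, inv_mul_cancel₀ hδ₀.ne', Real.rpow_one]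
  have hsel : M ^ (1 - δ) * A / (1 - (((d : ℝ) - 1) * t + δ * t)) < 2 ^ (-((d : ℝ) * t)) := by
    refine lt_of_eq_of_lt ?_ hMsel
    have : M ^ (-(δ / 2)) = M ^ (1 - δ) / M ^ (1 - δ / 2) := by
      rw [← Real.rpow_sub hMpos]
      ring_nf
    rw [this, hA_def]
    ring
  have hbud : (d : ℝ) ^ 2 * η ^ δ + (d : ℝ) ^ 2 * (2 ^ (d + 1) / M) ≤ A / 2 := by
    have h : (d : ℝ) ^ 2 * (2 ^ (d + 1) / M) ≤ A / 4 := by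
      rw [Real.rpow_neg hMpos.le, ← div_eq_mul_inv, div_lt_iff₀ (by positivity)] at hMbud
      rw [hMA, ← mul_div_assoc, div_div, mul_comm M 4, ← div_div]
      gcongr
      linarith
    linarith
  -- Here `(d-1)t < 1` makes a batch short compared with `n₀`.
  obtain ⟨N₁, hN₁⟩ := Filter.eventually_atTop.1 <| tendsto_natCast_atTop_atTop.eventually <|
    eventually_mul_rpow_neg_lt (sub_pos.2 ht) (C₂ ^ (d - 1)) hη₀
  have hC : ∀ n : ℕ, max 1 N₁ ≤ n → (C₂ * (n : ℝ) ^ t) ^ (d - 1) ≤ η * n := by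
    intro n hn
    have hn₀ : (0 : ℝ) < n := by exact_mod_cast (le_max_left 1 N₁).trans hn
    have h := hN₁ n ((le_max_right 1 N₁).trans hn)
    have hpow : ((n : ℝ) ^ t) ^ (d - 1) = (n : ℝ) ^ (-(1 - t * ((d : ℝ) - 1))) * n := by
      rw [← Real.rpow_add_one hn₀.ne', ← Real.rpow_natCast, ← Real.rpow_mul hn₀.le,
        Nat.cast_sub (by omega)]
      push_cast
      ring_nf
    rw [mul_pow, hpow, ← mul_assoc]
    exact mul_le_mul_of_nonneg_right h.le hn₀.le
  refine ⟨max 1 N₁, fun n₀ nmax hn₀ _ 𝓑 hpack hvol hsurf hw => ?_⟩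
  have hadm : IsAdmissible t δ A C₂ n₀ (fun B : 𝓑 => (B : Brick d).toAxisBox) := by
    refine ⟨fun B i => ((B : Brick d).side_pos i).le, fun B B' h => ?_, ?_, ?_, fun B i => ?_⟩
    · exact Brick.toAxisBox_sep (hpack B.2 B'.2 fun h' => h (Subtype.ext h'))
    · rw [← hvol, Brick.totalVol, ← Finset.sum_coe_sort 𝓑 Brick.vol]
      exact Finset.sum_congr rfl fun B _ => Brick.prod_side _
    · calc ∑ B : 𝓑, weightedSurf δ (B : Brick d).toAxisBox.side
          ≤ ∑ B : 𝓑, d * (B : Brick d).surf δ :=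
            Finset.sum_le_sum fun B _ => Brick.weightedSurf_side_le hδ₁.le _
        _ = d * Brick.totalSurf δ 𝓑 := by
            rw [← Finset.mul_sum, Brick.totalSurf, ← Finset.sum_coe_sort 𝓑 (Brick.surf δ)]
        _ ≤ _ := (mul_le_mul_of_nonneg_left hsurf hd₀.le).trans_eq (by rw [hA_def]; ring)
    · exact Brick.side_le_of_w_le (hw B B.2) i
  obtain ⟨a, ha, hsep⟩ := exists_packing_of_isAdmissible (le_max_left 1 N₁) hδ₀ hδ₁.le hA.le
    ht₀.le ht' hp he₀ htδ hM2 hη₀ hη₁ hsel hbud hC nmax nmax n₀ hn₀ (by omega) _ _ hadm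
  have hpos : ∀ n ∈ Set.Ico n₀ nmax, 0 < (n : ℝ) ^ (-t) := fun n hn =>
    Real.rpow_pos_of_pos (by exact_mod_cast (le_max_left 1 N₁).trans (hn₀.trans hn.1)) _
  -- The unit brick is a dummy value, needed only because bricks must be nondegenerate at every
  -- index.
  let Q : ℕ → Brick d := fun n =>
    if h : 0 < (n : ℝ) ^ (-t) then ⟨a n, fun i => a n i + (n : ℝ) ^ (-t), fun i => by linarith⟩
    else ⟨0, 1, fun _ => one_pos⟩
  have hQ : ∀ n ∈ Set.Ico n₀ nmax,
      (Q n).toAxisBox = AxisBox.cube (a n) ((n : ℝ) ^ (-t)) := fun n hn => by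
    simp only [Q, hpos n hn, dif_pos]
    rfl
  refine ⟨Q, fun n hn i => ?_, fun n hn m hm hnm => ?_, fun n hn => ?_⟩
  · exact (congrArg (fun B => B.side i) (hQ n hn)).trans (AxisBox.cube_side _ _ i)
  · have h := hsep hn hm hnm
    simp only [← hQ n hn, ← hQ m hm] at h
    exact h.disjoint_interior
  · obtain ⟨B, hB⟩ := ha n hn
    rw [← hQ n hn] at hB
    exact (Set.Icc_subset_Icc (fun i => (hB i).1) fun i => (hB i).2).trans
      (Set.subset_biUnion_of_mem (u := fun B : Brick d => B.toSet) B.2)
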